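/- Let $n\ge 2$ and let $d_1,\dots,d_n\ge 1$ be integers. **Diagram and fillings.** Let $\mathbb D=\{(i,\alpha)\,:\,1\le i\le n,\ \alpha\in\mathbb N^n,\ |\alpha|=d_i\}$, and let $F_i=\sum_{|\alpha|=d_i}a_{i,\alpha}x^\alpha$ ($1\le i\le n$) be the generic forms of degrees $d_i$ in $x_1,\dots,x_n$, with indeterminate coefficients $a=(a_{i,\alpha})_{(i,\alpha)\in\mathbb D}$. An effective filling is a map $A:\mathbb D\to\mathbb N$; put $a^A=\prod a_{i,\alpha}^{A_{i,\alpha}}$, $\mathrm{Row}_i(A)=\sum_\alpha A_{i,\alpha}$, $\|A\|=\sum_{(i,\alpha)} A_{i,\alpha}$ and $\mathrm{wt}(A)=\sum_{(i,\alpha)}A_{i,\alpha}\,\alpha$. For $S\subset\mathbb D$ let $\mathbf 1_SA$ be the filling that agrees with $A$ on $S$ and is $0$ elsewhere. For a set $S$ that contains exactly one cell of each row, let $P_S(A)$ be the filling with value $\mathrm{Row}_i(A)$ at the cell of $S$ in row $i$ (for each $i$), and $0$ elsewhere. Inequalities and sums of fillings are cellwise. For $\rho\in\mathbb N^n$ and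 an effective filling $A$ with $\mathrm{Row}(A)=\rho$ let $\begin{bmatrix}\rho\\A\end{bmatrix}=\prod_i\rho_i!\,/\prod_{(i,\alpha)}A_{i,\alpha}!$, a product of $n$ multinomial coefficients. **Inertia forms and the resultant.** Let $\delta_i=\prod_{j\ne i}d_j$ be the canonical multidegree. A polynomial $R\in\mathbb Q[a]$ is an inertia form of degree zero if there is $q\ge 0$ such that for every $\gamma\in\mathbb N^n$ with $|\gamma|=q$ there are $G_1,\dots,G_n\in\mathbb Q[a,x]$ with $x^\gamma R=\sum_iF_iG_i$. The resultant is the polynomial in $\mathbb Q[a]$ that, over $\mathbb C$, vanishes exactly at those systems of forms that have a common zero in $\mathbb C^n\setminus\{0\}$, that is homogeneous of degree $\delta_i$ in the coefficients of $F_i$ for each $i$, and whose value at $(x_1^{d_1},\dots,x_n^{d_n})$ is $1$. **Order and transition matrix.** Let $$\mathrm{REF}=\{A\in\mathbb N^{\mathbb D}:\mathrm{Row}(A)=\delta,\ \mathrm{wt}(A)=d_1\cdots d_n(1,\dots,1)\},\qquad \mathrm{FRR}=\{A\in\mathrm{REF}:A_{1,d_1e_1}=\delta_1\}$$ (the first-row-reduced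 fillings), $\mathbb E=\{(i,d_ie_i):1\le i\le n\}$ and $\mathbb T=\{(i,(d_i-1)e_1+e_{i+1}):1\le i<n\}\cup\{(n,d_ne_1)\}$. Let $\mathcal Z(A)=\|\mathbf 1_{\mathbb D\setminus(\mathbb E\cup\mathbb T)}A\|$. For $A,B\in\mathrm{REF}$ write $A\prec B$ if either $A\in\mathrm{FRR}$ and $B\notin\mathrm{FRR}$, or $A,B\notin\mathrm{FRR}$ and $\mathcal Z(A)<\mathcal Z(B)$. For $A\in\mathrm{REF}\setminus\mathrm{FRR}$ and $\widetilde A\in\mathrm{REF}$ let $C_A=\mathbf 1_{\mathbb D\setminus\mathbb E}A+P_{\mathbb T}(\mathbf 1_{\mathbb E}A)$ and $$\mathscr T(A,\widetilde A)=(-1)^{\|\mathbf 1_{\mathbb E}A\|+\|\mathbf 1_{\mathbb E}\widetilde A\|+1}\begin{bmatrix}\mathrm{Row}(\mathbf 1_{\mathbb E}\widetilde A)\\ C_A-\mathbf 1_{\mathbb D\setminus\mathbb E}\widetilde A\end{bmatrix}\quad\text{if }\mathbf 1_{\mathbb D\setminus\mathbb E}\widetilde A\le C_A,$$ and $\mathscr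 T(A,\widetilde A)=0$ otherwise. For $A\in\mathrm{REF}$ and $B\in\mathrm{FRR}$ let $\mathscr C(A,B)=1$ if $A=B$, let $\mathscr C(A,B)=0$ if $A\in\mathrm{FRR}$ and $A\ne B$, and, if $A\notin\mathrm{FRR}$, let $$\mathscr C(A,B)=\sum_{k\ge0}\ \sum_{\substack{A_1,\dots,A_k\in\mathrm{REF}\setminus\mathrm{FRR}\\ B\prec A_k\prec\cdots\prec A_1\prec A}}\mathscr T(A,A_1)\,\mathscr T(A_1,A_2)\cdots\mathscr T(A_{k-1},A_k)\,\mathscr T(A_k,B)$$ (the term $k=0$ is $\mathscr T(A,B)$; only finitely many $k$ contribute, namely $k\le\mathcal Z(A)$). **Statement.** Let $R=\sum_Ar_A\,a^A\in\mathbb Q[a]$ be an inertia form of degree zero that is multihomogeneous of the canonical multidegree $\delta$, or let $R$ be the resultant. Then: 1. for every $A\in\mathrm{REF}\setminus\mathrm{FRR}$, $$r_A=\sum_{\widetilde A\in\mathrm{REF},\ \widetilde A\prec A}\mathscr T(A,\widetilde A)\,r_{\widetilde A}\,;$$ 2. for every $A\in\mathrm{REF}$, $$r_A=\sum_{B\in\mathrm{FRR}}\mathscr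 C(A,B)\,r_B .$$ -/

import Mathlib

namespace InertiaForms

/-- Multiindices `α ∈ ℕⁿ` with `|α| = k`. -/
abbrev Multiindex (n k : ℕ) : Type := {α : Fin n → ℕ // ∑ j, α j = k}

instance (n k : ℕ) : Fintype (Multiindex n k) :=
  Fintype.subtype (Finset.piAntidiag Finset.univ k) (by simp)

/-- The diagram of the format `(n, n, d)`: its cells are the pairs `(i, α)` with `|α| = d i`.
Rows, variables and components of multiindices are numbered from `0`. -/
abbrev Cell {n : ℕ} (d : Fin n → ℕ) : Type := Σ i : Fin n, Multiindex n (d i)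

/-- Effective fillings of the diagram. -/
abbrev Filling {n : ℕ} (d : Fin n → ℕ) : Type := Cell d → ℕ

section Forms

variable {n : ℕ} (d : Fin n → ℕ)

/-- The generic form `F_i = ∑_{|α| = d i} a_{i,α} x^α` in `ℚ[a, x]`; the variable `a_c` is
`X (Sum.inl c)` and the variable `x_j` is `X (Sum.inr j)`. -/
noncomputable def genericForm (i : Fin n) : MvPolynomial (Cell d ⊕ Fin n) ℚ :=
  ∑ α : Multiindex n (d i),
    MvPolynomial.X (Sum.inl ⟨i, α⟩) * ∏ j, MvPolynomial.X (Sum.inr j) ^ (α.1 j)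

/-- `R ∈ ℚ[a]` is an inertia form of degree zero: for some `q`, each `x^γ R` with `|γ| = q`
lies in the ideal generated by the generic forms in `ℚ[a, x]`. -/
def IsInertiaForm (R : MvPolynomial (Cell d) ℚ) : Prop :=
  ∃ q : ℕ, ∀ γ : Fin n → ℕ, ∑ j, γ j = q →
    ∃ G : Fin n → MvPolynomial (Cell d ⊕ Fin n) ℚ,
      (∏ j, MvPolynomial.X (Sum.inr j) ^ (γ j)) * MvPolynomial.rename Sum.inl R
        = ∑ i, genericForm d i * G i

variable {d}

/-- The row sums of a filling. -/
def rowSum (A : Filling d) (i : Fin n) : ℕ := ∑ α : Multiindex n (d i), A ⟨i, α⟩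

/-- The total `‖A‖`. -/
def total (A : Filling d) : ℕ := ∑ c, A c

/-- The weight vector `wt A = ∑_{(i,α)} A_{i,α} α`. -/
def weight (A : Filling d) (j : Fin n) : ℕ := ∑ c : Cell d, A c * c.2.1 j

/-- `R` is homogeneous of degree `δ i` in the coefficients of the `i`-th form, for each `i`. -/
def IsMultihomogeneous (R : MvPolynomial (Cell d) ℚ) (δ : Fin n → ℕ) : Prop :=
  ∀ A : Cell d →₀ ℕ, MvPolynomial.coeff A R ≠ 0 → ∀ i, rowSum (fun c => A c) i = δ i

/-- The coefficient `r_A` of the monomial `a^A` in `R`. -/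
noncomputable def fillingCoeff (R : MvPolynomial (Cell d) ℚ) (A : Filling d) : ℚ :=
  MvPolynomial.coeff (Finsupp.equivFunOnFinite.symm A) R

variable (d)

/-- The canonical multidegree `δ_i = ∏_{j ≠ i} d_j`. -/
def canonicalDegree (i : Fin n) : ℕ := ∏ j ∈ Finset.univ.erase i, d j

/-- The diagonal transversal `𝔼`: the cells `(i, d_i e_i)`. -/
def diagTransversal : Finset (Cell d) :=
  Finset.univ.filter fun c => c.2.1 = Pi.single c.1 (d c.1)

/-- `R` is the resultant of `n` forms in `n` variables of degrees `d`: over `ℂ` it vanishes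
exactly at the systems of forms having a common nontrivial zero, it has the canonical
multidegree, and its value at `x_1^{d_1}, …, x_n^{d_n}` is `1`. -/
structure IsResultant (R : MvPolynomial (Cell d) ℚ) : Prop where
  vanishing : ∀ a : Cell d → ℂ, MvPolynomial.aeval a R = 0 ↔
    ∃ x : Fin n → ℂ, x ≠ 0 ∧
      ∀ i, ∑ α : Multiindex n (d i), a ⟨i, α⟩ * ∏ j, x j ^ (α.1 j) = 0
  multidegree : IsMultihomogeneous R (canonicalDegree d)
  normalized : MvPolynomial.eval (fun c => if c ∈ diagTransversal d then (1 : ℚ) else 0) R = 1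

/-- The set `EF(δ)` of effective fillings with row sums `δ`. -/
def effectiveFillings (δ : Fin n → ℕ) : Finset (Filling d) :=
  (Fintype.piFinset fun c : Cell d => Finset.range (δ c.1 + 1)).filter fun A => rowSum A = δ

theorem mem_effectiveFillings (δ : Fin n → ℕ) (A : Filling d) :
    A ∈ effectiveFillings d δ ↔ rowSum A = δ := by
  simp only [effectiveFillings, Finset.mem_filter, Fintype.mem_piFinset, Finset.mem_range,
    and_iff_right_iff_imp]
  rintro rfl ⟨i, α⟩
  exact Nat.lt_succ_of_le
    (Finset.single_le_sum (f := fun α => A ⟨i, α⟩) (fun _ _ => Nat.zero_le _)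
      (Finset.mem_univ α))

/-- `REF`: the effective fillings of canonical multidegree whose weight is
`d_1 ⋯ d_n (1, …, 1)`. -/
def REF : Finset (Filling d) :=
  (effectiveFillings d (canonicalDegree d)).filter fun A => weight A = fun _ => ∏ i, d i

variable {d}

/-- The pointwise product `𝟏_S A`. -/
def restrict (S : Finset (Cell d)) (A : Filling d) : Filling d :=
  fun c => if c ∈ S then A c else 0

/-- The push `P_S A` of the filling `A` to the transversal `S`. -/
def push (S : Finset (Cell d)) (A : Filling d) : Filling d :=
  fun c => if c ∈ S then rowSum A c.1 else 0

/-- The product of multinomial coefficients `∏_i ρ_i! / ∏_{(i,α)} A_{i,α}!`, to be used when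
`A` has row sums `ρ`; the division is then exact. -/
def supernomial (ρ : Fin n → ℕ) (A : Filling d) : ℕ :=
  (∏ i, (ρ i).factorial) / ∏ c, (A c).factorial

theorem supernomial_rowSum (A : Filling d) :
    supernomial (rowSum A) A
      = ∏ i, Nat.multinomial Finset.univ fun α : Multiindex n (d i) => A ⟨i, α⟩ := by
  unfold supernomial
  refine Nat.div_eq_of_eq_mul_right (Finset.prod_pos fun c _ => Nat.factorial_pos _) ?_
  rw [Fintype.prod_sigma, ← Finset.prod_mul_distrib]
  exact Finset.prod_congr rfl fun i _ => (Nat.multinomial_spec _ _).symm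

end Forms

section Reduction

variable {n : ℕ} [NeZero n] (d : Fin n → ℕ)

/-- The row `τ_i` of the second transversal: `(d_i - 1) e_1 + e_{i+1}` for `i < n`, and
`d_n e_1` for the last row. -/
def tauRow (i : Fin n) : Fin n → ℕ :=
  if h : i.1 + 1 < n then
    Pi.single (0 : Fin n) (d i - 1) + Pi.single (⟨i.1 + 1, h⟩ : Fin n) 1
  else Pi.single (0 : Fin n) (d i)

/-- The transversal `𝕋`: the cells `(i, τ_i)`. -/
def tauTransversal : Finset (Cell d) :=
  Finset.univ.filter fun c => c.2.1 = tauRow d c.1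

/-- The cell `(1, d_1 e_1)`. -/
def firstCell : Cell d := ⟨0, Pi.single (0 : Fin n) (d 0), by simp⟩

/-- `FRR`: the first-row-reduced fillings in `REF`. -/
def FRR : Finset (Filling d) :=
  (REF d).filter fun A => A (firstCell d) = canonicalDegree d 0

variable {d}

/-- The counter `𝒵(A)`: the sum of the entries of `A` outside `𝔼 ∪ 𝕋`. -/
def counter (A : Filling d) : ℕ :=
  total (restrict (diagTransversal d ∪ tauTransversal d)ᶜ A)

/-- The strict partial order `A ≺ B` on `REF`. -/
abbrev Prec (A B : Filling d) : Prop :=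
  (A ∈ FRR d ∧ B ∉ FRR d) ∨ ((A ∉ FRR d ∧ B ∉ FRR d) ∧ counter A < counter B)

/-- The filling `𝟏_{𝔻∖𝔼} A + P_𝕋(𝟏_𝔼 A)`. -/
def resolventFilling (A : Filling d) : Filling d :=
  restrict (diagTransversal d)ᶜ A + push (tauTransversal d) (restrict (diagTransversal d) A)

/-- The transition matrix `𝒯(A, A')`. The subtraction of fillings is cellwise and is only used
when no entry becomes negative. -/
def transition (A A' : Filling d) : ℤ :=
  if ∀ c, restrict (diagTransversal d)ᶜ A' c ≤ resolventFilling A c then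
    (-1) ^ (total (restrict (diagTransversal d) A) + total (restrict (diagTransversal d) A') + 1) *
      (supernomial (rowSum (restrict (diagTransversal d) A'))
        (resolventFilling A - restrict (diagTransversal d)ᶜ A') : ℤ)
  else 0

/-- The sequence `A, A_1, …, A_k, B`. -/
def path {k : ℕ} (A : Filling d) (p : Fin k → Filling d) (B : Filling d) :
    Fin (k + 2) → Filling d :=
  Fin.cons (α := fun _ => Filling d) A (Fin.snoc (α := fun _ => Filling d) p B)

/-- The sum, over all `A_1, …, A_k ∈ REF ∖ FRR` with `B ≺ A_k ≺ ⋯ ≺ A_1 ≺ A`, of the products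
`𝒯(A, A_1) 𝒯(A_1, A_2) ⋯ 𝒯(A_k, B)`. -/
def pathSum (k : ℕ) (A B : Filling d) : ℤ :=
  ∑ p ∈ (Fintype.piFinset fun _ : Fin k => REF d \ FRR d) with
      ∀ i : Fin (k + 1), Prec (path A p B i.succ) (path A p B i.castSucc),
    ∏ i : Fin (k + 1), transition (path A p B i.castSucc) (path A p B i.succ)

/-- The sum over `k` in the next definition is finite: each step of a chain decreases the
counter, so that there is no chain with `k > 𝒵(A)`. -/
theorem pathSum_eq_zero {k : ℕ} {A : Filling d} (B : Filling d) (hk : counter A < k) :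
    pathSum k A B = 0 := by
  refine Finset.sum_eq_zero fun p hp => ?_
  exfalso
  rw [Finset.mem_filter, Fintype.mem_piFinset] at hp
  obtain ⟨hp, hc⟩ := hp
  have hs : ∀ (j : ℕ) (hj : j < k), path A p B ⟨j + 1, by omega⟩ = p ⟨j, hj⟩ := by
    intro j hj
    have h1 : (⟨j + 1, by omega⟩ : Fin (k + 2)) = (Fin.castSucc ⟨j, hj⟩ : Fin (k + 1)).succ := rfl
    rw [path, h1, Fin.cons_succ, Fin.snoc_castSucc]
  have key : ∀ (j : ℕ) (hj : j ≤ k), counter (path A p B ⟨j, by omega⟩) + j ≤ counter A := by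
    intro j
    induction j with
    | zero => intro _; exact le_refl _
    | succ j ih =>
      intro hj
      have h := hc ⟨j, by omega⟩
      have h2 := ih (by omega)
      have hm := (Finset.mem_sdiff.mp (hp ⟨j, hj⟩)).2
      rw [← hs j hj] at hm
      rcases h with h | h
      · exact absurd h.1 hm
      · have h3 : counter (path A p B ⟨j + 1, by omega⟩) < counter (path A p B ⟨j, by omega⟩) := h.2
        omega
  have := key k le_rfl
  omega

/-- The matrix element `𝒞(A, B)`. -/
noncomputable def reductionCoeff (A B : Filling d) : ℤ :=
  if A ∈ FRR d then (if A = B then 1 else 0) else ∑ᶠ k : ℕ, pathSum k A B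

end Reduction

end InertiaForms

open InertiaForms

/-! Apart from its multidegree, only one property of `R` is used: it vanishes at every complex
system with a nontrivial common zero. If the coefficients of each form sum to zero, multiplying them
by `t^α` gives a system with the zero `t⁻¹`. Hence each weight component of `R` vanishes separately
at the systems with the zero `(1, …, 1)` (`VanishesOnSolvable.sum_weight_eq`). For the weight of
`REF`, eliminating the diagonal coefficient of each row turns this into a polynomial identity, whose
coefficient at `a^{C_A}` is, up to sign, the relation `∑ 𝒯(A, A') r_{A'} = 0`
(`VanishesOnSolvable.sum_transition_eq_zero`).

This relation can be solved for `r_A`, since `𝒯(A, A) = -1` and every other contributing filling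
precedes `A` (`prec_of_le_resolventFilling`). Indeed, a contributing `A'` is cellwise at most `A`
off `𝔼 ∪ 𝕋`; if it is not first-row-reduced and its counter is not smaller, it agrees with `A`
there. Row sums and weights then express all differences through that of the first diagonal entries,
and make the latter a multiple of `δ_1`. Both entries lie in `[0, δ_1)`, so `A' = A`
(`eq_of_agree`).

The second claim iterates the first: each step that stays outside `FRR` lowers the counter. -/

namespace InertiaForms

/-! ### Vanishing on solvable systems, and its weight components -/

section Vanishing

variable {n : ℕ} {d : Fin n → ℕ}

/-- `R` vanishes at every system of complex forms with a common nontrivial zero. -/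
def VanishesOnSolvable (R : MvPolynomial (Cell d) ℚ) : Prop :=
  ∀ (a : Cell d → ℂ) (x : Fin n → ℂ), x ≠ 0 →
    (∀ i, ∑ α : Multiindex n (d i), a ⟨i, α⟩ * ∏ j, x j ^ (α.1 j) = 0) →
      MvPolynomial.aeval a R = 0

theorem aeval_genericForm (a : Cell d → ℂ) (x : Fin n → ℂ) (i : Fin n) :
    MvPolynomial.aeval (Sum.elim a x) (genericForm d i)
      = ∑ α : Multiindex n (d i), a ⟨i, α⟩ * ∏ j, x j ^ (α.1 j) := by
  simp [genericForm]

theorem IsInertiaForm.vanishesOnSolvable {R : MvPolynomial (Cell d) ℚ} (hR : IsInertiaForm d R) :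
    VanishesOnSolvable R := by
  intro a x hx ha
  obtain ⟨q, hq⟩ := hR
  obtain ⟨j, hj⟩ := Function.ne_iff.mp hx
  -- With `x_j ≠ 0`, the monomial `x_j^q` does not vanish at the common zero and can be cancelled.
  obtain ⟨G, hG⟩ := hq (Pi.single j q) (by simp)
  have h := congrArg (MvPolynomial.aeval (Sum.elim a x)) hG
  simp only [map_mul, map_sum, aeval_genericForm, ha, zero_mul, Finset.sum_const_zero, map_prod,
    map_pow, MvPolynomial.aeval_X, Sum.elim_inr, MvPolynomial.aeval_rename] at h
  rw [Sum.elim_comp_inl] at h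
  refine (mul_eq_zero.mp h).resolve_left (Finset.prod_ne_zero_iff.mpr fun k _ => ?_)
  by_cases hk : k = j
  · subst hk
    exact pow_ne_zero _ hj
  · simp [hk]

theorem IsResultant.vanishesOnSolvable {R : MvPolynomial (Cell d) ℚ} (hR : IsResultant d R) :
    VanishesOnSolvable R :=
  fun a x hx ha => (hR.vanishing a).mpr ⟨x, hx, ha⟩

theorem aeval_eq_sum_fillingCoeff {R : MvPolynomial (Cell d) ℚ} {δ : Fin n → ℕ}
    (hR : IsMultihomogeneous R δ) (a : Cell d → ℂ) :
    MvPolynomial.aeval a R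
      = ∑ A ∈ effectiveFillings d δ, (fillingCoeff R A : ℂ) * ∏ c, a c ^ A c := by
  rw [MvPolynomial.aeval_def, MvPolynomial.eval₂_eq']
  -- Fillings outside the support have coefficient zero, so only nonzero terms are matched;
  -- multihomogeneity places the support among the fillings with row sums `δ`.
  refine Finset.sum_bij_ne_zero (fun m _ _ => ⇑m) ?_ ?_ ?_ ?_
  · intro m hm _
    rw [mem_effectiveFillings]
    exact funext (hR m (MvPolynomial.mem_support_iff.mp hm))
  · intro m _ _ m' _ _ h
    exact DFunLike.coe_injective h
  · intro A _ hA
    refine ⟨Finsupp.equivFunOnFinite.symm A, ?_, ?_, ?_⟩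
    · rw [MvPolynomial.mem_support_iff]
      intro h
      exact hA (by simp [fillingCoeff, h])
    · simpa [fillingCoeff] using hA
    · rfl
  · intro m _ _
    simp [fillingCoeff]

/-- The linear substitution that makes the coefficients of each form sum to zero: the
coefficient of `x_i ^ d_i` in the `i`-th form becomes minus the sum of the other ones. -/
noncomputable def zeroSumSubst {S : Type*} [CommRing S] (b : Cell d → S) : Cell d → S := fun c =>
  if c ∈ diagTransversal d then
    -∑ α : Multiindex n (d c.1) with ⟨c.1, α⟩ ∉ diagTransversal d, b ⟨c.1, α⟩
  else b c

variable (d) in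
/-- The multiindex `d_i e_i`. -/
def diagIndex (i : Fin n) : Multiindex n (d i) := ⟨Pi.single i (d i), by simp⟩

theorem mem_diagTransversal_iff {i : Fin n} {α : Multiindex n (d i)} :
    (⟨i, α⟩ : Cell d) ∈ diagTransversal d ↔ α = diagIndex d i := by
  simp [diagTransversal, diagIndex, Subtype.ext_iff]

theorem diagIndex_mem (i : Fin n) : (⟨i, diagIndex d i⟩ : Cell d) ∈ diagTransversal d :=
  mem_diagTransversal_iff.mpr rfl

theorem sum_filter_mem_diagTransversal {M : Type*} [AddCommMonoid M] (f : Cell d → M) (i : Fin n) :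
    ∑ α : Multiindex n (d i) with ⟨i, α⟩ ∈ diagTransversal d, f ⟨i, α⟩ = f ⟨i, diagIndex d i⟩ := by
  rw [Finset.filter_congr fun α _ => mem_diagTransversal_iff (α := α), Finset.filter_eq',
    if_pos (Finset.mem_univ _), Finset.sum_singleton]

theorem sum_zeroSumSubst {S : Type*} [CommRing S] (b : Cell d → S) (i : Fin n) :
    ∑ α : Multiindex n (d i), zeroSumSubst b ⟨i, α⟩ = 0 := by
  rw [← Finset.sum_filter_add_sum_filter_not Finset.univ
    (fun α : Multiindex n (d i) => (⟨i, α⟩ : Cell d) ∈ diagTransversal d),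
    sum_filter_mem_diagTransversal (zeroSumSubst b)]
  rw [Finset.sum_congr rfl (g := fun α => b ⟨i, α⟩) (f := fun α => zeroSumSubst b ⟨i, α⟩)
    fun α hα => if_neg (Finset.mem_filter.mp hα).2]
  rw [zeroSumSubst, if_pos (diagIndex_mem i)]
  exact neg_add_cancel _

/-- The forms with coefficients `b_{i,α} t^α` have the common zero `t⁻¹` when the coefficients
`b_{i,α}` of each form sum to zero. -/
theorem VanishesOnSolvable.aeval_scaled [NeZero n] {R : MvPolynomial (Cell d) ℚ}
    (hR : VanishesOnSolvable R) {b : Cell d → ℂ}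
    (hb : ∀ i, ∑ α : Multiindex n (d i), b ⟨i, α⟩ = 0) {t : Fin n → ℂ} (ht : ∀ j, t j ≠ 0) :
    MvPolynomial.aeval (fun c : Cell d => b c * ∏ j, t j ^ (c.2.1 j)) R = 0 := by
  refine hR _ (fun j => (t j)⁻¹) (fun h => inv_ne_zero (ht 0) (congrFun h 0)) fun i => ?_
  rw [← hb i]
  refine Finset.sum_congr rfl fun α _ => ?_
  rw [mul_assoc, ← Finset.prod_mul_distrib, Finset.prod_eq_one, mul_one]
  intro j _
  rw [← mul_pow, mul_inv_cancel₀ (ht j), one_pow]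

/-- The part of given weight of a form that vanishes on solvable systems vanishes at the systems
with the common zero `(1, …, 1)`. -/
theorem VanishesOnSolvable.sum_weight_eq [NeZero n] {R : MvPolynomial (Cell d) ℚ}
    (hR : VanishesOnSolvable R) {δ : Fin n → ℕ} (hδ : IsMultihomogeneous R δ) {b : Cell d → ℂ}
    (hb : ∀ i, ∑ α : Multiindex n (d i), b ⟨i, α⟩ = 0) (w : Fin n → ℕ) :
    ∑ A ∈ effectiveFillings d δ with weight A = w,
      (fillingCoeff R A : ℂ) * ∏ c, b c ^ A c = 0 := by
  -- The value at the scaled system, read as a polynomial in `t`: its coefficient at `t^w` is the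
  -- part of weight `w`.
  have key : ∑ A ∈ effectiveFillings d δ, MvPolynomial.monomial
      (Finsupp.equivFunOnFinite.symm (weight A)) ((fillingCoeff R A : ℂ) * ∏ c, b c ^ A c) = 0 := by
    -- The zero `t⁻¹` requires all `t_j ≠ 0`; this still leaves infinitely many values for each
    -- coordinate.
    refine MvPolynomial.funext_set (fun _ : Fin n => ({0}ᶜ : Set ℂ))
      (fun _ => (Set.finite_singleton 0).infinite_compl) fun t ht => ?_
    rw [map_zero, ← hR.aeval_scaled hb (t := t) (fun j => ht j (Set.mem_univ j)),
      aeval_eq_sum_fillingCoeff hδ, map_sum]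
    refine Finset.sum_congr rfl fun A _ => ?_
    rw [MvPolynomial.eval_monomial, mul_assoc]
    congr 1
    simp only [mul_pow, Finset.prod_mul_distrib]
    congr 1
    rw [Finsupp.prod_fintype _ _ (fun _ => pow_zero _)]
    simp only [Finsupp.equivFunOnFinite_symm_apply_apply, weight, ← Finset.prod_pow, ← pow_mul]
    rw [Finset.prod_comm]
    refine Finset.prod_congr rfl fun j _ => ?_
    rw [Finset.prod_pow_eq_pow_sum]
    simp only [mul_comm]
  have h := congrArg (MvPolynomial.coeff (Finsupp.equivFunOnFinite.symm w)) key
  rw [MvPolynomial.coeff_sum, MvPolynomial.coeff_zero] at h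
  rw [Finset.sum_filter]
  refine Eq.trans ?_ h
  refine Finset.sum_congr rfl fun A _ => ?_
  rw [MvPolynomial.coeff_monomial]
  simp only [EmbeddingLike.apply_eq_iff_eq]

/-- The off-diagonal coefficients parametrise the zero-sum systems freely, so vanishing at all
complex values becomes an identity in indeterminates, whose coefficients can be compared. -/
theorem VanishesOnSolvable.sum_zeroSumSubst_eq_zero [NeZero n] {R : MvPolynomial (Cell d) ℚ}
    (hR : VanishesOnSolvable R) (hδ : IsMultihomogeneous R (canonicalDegree d)) :
    ∑ A ∈ REF d, MvPolynomial.C (fillingCoeff R A : ℂ) *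
      ∏ c, zeroSumSubst (MvPolynomial.X : Cell d → MvPolynomial (Cell d) ℂ) c ^ A c = 0 := by
  refine MvPolynomial.funext fun b => ?_
  rw [map_zero, ← hR.sum_weight_eq hδ (sum_zeroSumSubst b), map_sum]
  refine Finset.sum_congr rfl fun A _ => ?_
  rw [map_mul, MvPolynomial.eval_C, map_prod]
  congr 1
  refine Finset.prod_congr rfl fun c _ => ?_
  rw [map_pow]
  congr 1
  unfold zeroSumSubst
  split_ifs <;> simp

end Vanishing

/-! ### Coefficients after elimination of the diagonal -/

section Coefficients

variable {n : ℕ} {d : Fin n → ℕ}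

theorem prod_cell_eq {M : Type*} [CommMonoid M] (f : Cell d → M) :
    ∏ c, f c = (∏ c ∈ (diagTransversal d)ᶜ, f c) * ∏ i, f ⟨i, diagIndex d i⟩ := by
  rw [← Finset.prod_compl_mul_prod (diagTransversal d) f]
  congr 1
  refine Finset.prod_nbij' (fun c => c.1) (fun i => ⟨i, diagIndex d i⟩)
    (fun _ _ => Finset.mem_univ _) (fun i _ => diagIndex_mem i) ?_ (fun _ _ => rfl) ?_
  all_goals
    rintro ⟨i, α⟩ h
    obtain rfl := mem_diagTransversal_iff.mp h
    rfl

theorem rowSum_restrict_diag (A : Filling d) (i : Fin n) :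
    rowSum (restrict (diagTransversal d) A) i = A ⟨i, diagIndex d i⟩ := by
  rw [← sum_filter_mem_diagTransversal A, Finset.sum_filter]
  rfl

theorem rowSum_restrict_add_compl (S : Finset (Cell d)) (A : Filling d) :
    rowSum (restrict S A) + rowSum (restrict Sᶜ A) = rowSum A := by
  funext i
  simp only [Pi.add_apply, rowSum, ← Finset.sum_add_distrib]
  refine Finset.sum_congr rfl fun α _ => ?_
  by_cases h : (⟨i, α⟩ : Cell d) ∈ S <;> simp [restrict, h]

theorem rowSum_of_mem_REF {A : Filling d} (hA : A ∈ REF d) : rowSum A = canonicalDegree d :=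
  (mem_effectiveFillings d _ A).mp (Finset.mem_filter.mp hA).1

theorem total_eq_sum_rowSum (A : Filling d) : total A = ∑ i, rowSum A i :=
  Fintype.sum_sigma A

theorem multinomial_eq_of_subset {α : Type*} {s t : Finset α} (h : s ⊆ t) {f : α → ℕ}
    (hf : ∀ a ∈ t, a ∉ s → f a = 0) : Nat.multinomial s f = Nat.multinomial t f := by
  unfold Nat.multinomial
  rw [Finset.sum_subset h hf, Finset.prod_subset h fun a ha ha' => by rw [hf a ha ha']; rfl]

theorem prod_X_pow_eq_monomial {σ S : Type*} [Fintype σ] [CommSemiring S] (m : σ → ℕ) :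
    ∏ c, (MvPolynomial.X c : MvPolynomial σ S) ^ m c
      = MvPolynomial.monomial (Finsupp.equivFunOnFinite.symm m) 1 := by
  rw [MvPolynomial.monomial_eq, Finsupp.prod_fintype _ _ fun _ => pow_zero _]
  simp

/-- The coefficients of a product of powers of sums of variables, one sum for each row. -/
theorem coeff_prod_sum_X_pow {S : Type*} [CommSemiring S]
    (s : ∀ i : Fin n, Finset (Multiindex n (d i))) {M : Filling d}
    (hM : ∀ i, ∀ α ∉ s i, M ⟨i, α⟩ = 0) :
    MvPolynomial.coeff (Finsupp.equivFunOnFinite.symm M)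
      (∏ i, (∑ α ∈ s i, (MvPolynomial.X ⟨i, α⟩ : MvPolynomial (Cell d) S)) ^ rowSum M i)
      = (supernomial (rowSum M) M : S) := by
  simp only [Finset.sum_pow_eq_sum_piAntidiag]
  have hterm : ∀ p ∈ Fintype.piFinset (fun i : Fin n => Finset.piAntidiag (s i) (rowSum M i)),
      ∏ i, ((Nat.multinomial (s i) (p i) : MvPolynomial (Cell d) S) *
          ∏ α ∈ s i, MvPolynomial.X (⟨i, α⟩ : Cell d) ^ p i α)
        = MvPolynomial.monomial
          (Finsupp.equivFunOnFinite.symm fun c : Cell d => p c.1 c.2)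
          ((∏ i, Nat.multinomial (s i) (p i) : ℕ) : S) := by
    intro p hp
    rw [Finset.prod_mul_distrib, ← Nat.cast_prod, ← map_natCast (MvPolynomial.C (σ := Cell d)),
      ← mul_one (Nat.cast (R := S) _), ← MvPolynomial.C_mul_monomial, ← prod_X_pow_eq_monomial,
      Fintype.prod_sigma]
    congr 1
    · rw [mul_one]
    refine Finset.prod_congr rfl fun i _ => Finset.prod_subset (Finset.subset_univ (s i)) ?_
    intro α _ hα
    have h := (Finset.mem_piAntidiag.mp (Fintype.mem_piFinset.mp hp i)).2 α
    rw [not_imp_comm.mp h hα, pow_zero]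
  -- Only the choice of exponents given by the rows of `M` itself produces the monomial `a^M`.
  rw [Finset.prod_univ_sum, Finset.sum_congr rfl hterm, MvPolynomial.coeff_sum,
    Finset.sum_eq_single fun (i : Fin n) (α : Multiindex n (d i)) => M ⟨i, α⟩]
  · rw [MvPolynomial.coeff_monomial, if_pos rfl, supernomial_rowSum]
    congr 1
    refine Finset.prod_congr rfl fun i _ => multinomial_eq_of_subset (Finset.subset_univ _) ?_
    exact fun α _ hα => hM i α hα
  · intro p _ hp
    rw [MvPolynomial.coeff_monomial, if_neg]
    intro h
    refine hp (funext fun i => funext fun α => ?_)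
    exact congrFun (Finsupp.equivFunOnFinite.symm.injective h) ⟨i, α⟩
  · intro h
    refine absurd (Fintype.mem_piFinset.mpr fun i => ?_) h
    rw [Finset.mem_piAntidiag]
    refine ⟨Finset.sum_subset (Finset.subset_univ _) fun α _ hα => hM i α hα, fun α hα => ?_⟩
    exact not_imp_comm.mp (hM i α) hα

/-- Cells off the diagonal contribute a monomial; diagonal cells contribute a sign and powers of row
sums, the source of the multinomial coefficients. -/
theorem prod_zeroSumSubst_pow {S : Type*} [CommRing S] (A : Filling d) :
    ∏ c, zeroSumSubst (MvPolynomial.X : Cell d → MvPolynomial (Cell d) S) c ^ A c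
      = MvPolynomial.monomial
          (Finsupp.equivFunOnFinite.symm (restrict (diagTransversal d)ᶜ A))
          ((-1) ^ total (restrict (diagTransversal d) A)) *
        ∏ i, (∑ α : Multiindex n (d i) with ⟨i, α⟩ ∉ diagTransversal d,
          (MvPolynomial.X ⟨i, α⟩ : MvPolynomial (Cell d) S)) ^
            rowSum (restrict (diagTransversal d) A) i := by
  rw [prod_cell_eq, ← mul_one ((-1) ^ _), ← MvPolynomial.C_mul_monomial, ← prod_X_pow_eq_monomial,
    mul_comm (MvPolynomial.C _), mul_assoc]
  congr 1
  · rw [← Finset.prod_subset (Finset.subset_univ (diagTransversal d)ᶜ)]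
    · refine Finset.prod_congr rfl fun c hc => ?_
      rw [zeroSumSubst, if_neg (Finset.mem_compl.mp hc), restrict, if_pos hc]
    · intro c _ hc
      rw [restrict, if_neg hc, pow_zero]
  · rw [total_eq_sum_rowSum, ← Finset.prod_pow_eq_pow_sum, map_prod, ← Finset.prod_mul_distrib]
    refine Finset.prod_congr rfl fun i _ => ?_
    rw [rowSum_restrict_diag, zeroSumSubst, if_pos (diagIndex_mem i), map_pow, ← mul_pow]
    simp

/-- The coefficient of `a^C` in the result of substituting, in `a^A`, the generic systems with
the zero `(1, …, 1)`. -/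
theorem coeff_prod_zeroSumSubst_pow {S : Type*} [CommRing S] {A C : Filling d}
    (hC : ∀ c ∈ diagTransversal d, C c = 0) (hrow : rowSum C = rowSum A) :
    MvPolynomial.coeff (Finsupp.equivFunOnFinite.symm C)
      (∏ c, zeroSumSubst (MvPolynomial.X : Cell d → MvPolynomial (Cell d) S) c ^ A c)
      = if ∀ c, restrict (diagTransversal d)ᶜ A c ≤ C c then
          (-1) ^ total (restrict (diagTransversal d) A) *
            (supernomial (rowSum (restrict (diagTransversal d) A))
              (C - restrict (diagTransversal d)ᶜ A) : S)
        else 0 := by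
  rw [prod_zeroSumSubst_pow, MvPolynomial.coeff_monomial_mul']
  by_cases h : ∀ c, restrict (diagTransversal d)ᶜ A c ≤ C c
  -- The row sums left after removing the monomial must equal the exponents of the row factors; this
  -- is where `hrow` enters.
  · have hsub : rowSum (restrict (diagTransversal d) A)
        = rowSum (C - restrict (diagTransversal d)ᶜ A) := by
      have h1 : rowSum (C - restrict (diagTransversal d)ᶜ A)
          + rowSum (restrict (diagTransversal d)ᶜ A) = rowSum C := by
        funext i
        simp only [Pi.add_apply, rowSum, ← Finset.sum_add_distrib, Pi.sub_apply]
        exact Finset.sum_congr rfl fun α _ => Nat.sub_add_cancel (h ⟨i, α⟩)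
      refine add_right_cancel (b := rowSum (restrict (diagTransversal d)ᶜ A)) ?_
      rw [h1, hrow, rowSum_restrict_add_compl]
    have hm : Finsupp.equivFunOnFinite.symm C
          - Finsupp.equivFunOnFinite.symm (restrict (diagTransversal d)ᶜ A)
        = Finsupp.equivFunOnFinite.symm (C - restrict (diagTransversal d)ᶜ A) := by
      ext c
      simp
    rw [if_pos (show _ ≤ _ from fun c => h c), if_pos h, hm, hsub, coeff_prod_sum_X_pow]
    intro i α hα
    have hα' : (⟨i, α⟩ : Cell d) ∈ diagTransversal d := by simpa using hα
    simp [hC _ hα']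
  · rw [if_neg (fun h' => h fun c => h' c), if_neg h]

end Coefficients

/-! ### Triangularity of the linear relations -/

section Order

variable {n : ℕ} [NeZero n] {d : Fin n → ℕ}

theorem sum_tauRow (hd : ∀ i, 0 < d i) (i : Fin n) : ∑ j, tauRow d i j = d i := by
  unfold tauRow
  split_ifs
  · simp only [Pi.add_apply, Finset.sum_add_distrib, Finset.sum_pi_single', Finset.mem_univ,
      if_true]
    have := hd i
    omega
  · simp

/-- The multiindex `τ_i`. -/
def tauIndex (hd : ∀ i, 0 < d i) (i : Fin n) : Multiindex n (d i) := ⟨tauRow d i, sum_tauRow hd i⟩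

theorem mem_tauTransversal_iff (hd : ∀ i, 0 < d i) {i : Fin n} {α : Multiindex n (d i)} :
    (⟨i, α⟩ : Cell d) ∈ tauTransversal d ↔ α = tauIndex hd i := by
  simp [tauTransversal, tauIndex, Subtype.ext_iff]

/-- A row `i` other than the last is told apart by the variable `i + 1`. In the last row `τ` is
supported on the variable `0`, which differs from `i` because `n ≥ 2`. -/
theorem tauRow_ne_single {i : Fin n} (hn : 2 ≤ n) (hd : ∀ i, 0 < d i) :
    tauRow d i ≠ Pi.single i (d i) := by
  intro h
  have hdi := hd i
  unfold tauRow at h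
  split_ifs at h with hi
  · have h1 := congrFun h ⟨i.1 + 1, hi⟩
    have h2 : (⟨i.1 + 1, hi⟩ : Fin n) ≠ i := fun h => by
      have := congrArg Fin.val h
      simp at this
    rw [Pi.add_apply, Pi.single_eq_same, Pi.single_eq_of_ne h2] at h1
    omega
  · have h1 := congrFun h i
    have h2 : i ≠ 0 := fun h => by
      have := congrArg Fin.val h
      simp only [Fin.val_zero] at this
      omega
    rw [Pi.single_eq_same, Pi.single_eq_of_ne h2] at h1
    omega

theorem tauIndex_ne_diagIndex (hn : 2 ≤ n) (hd : ∀ i, 0 < d i) (i : Fin n) :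
    tauIndex hd i ≠ diagIndex d i :=
  fun h => tauRow_ne_single hn hd (congrArg Subtype.val h)

theorem disjoint_diag_tau (hn : 2 ≤ n) (hd : ∀ i, 0 < d i) :
    Disjoint (diagTransversal d) (tauTransversal d) := by
  rw [Finset.disjoint_left]
  rintro ⟨i, α⟩ h1 h2
  rw [mem_diagTransversal_iff] at h1
  rw [mem_tauTransversal_iff hd] at h2
  exact tauIndex_ne_diagIndex hn hd i (h2.symm.trans h1)

theorem rowSum_push_tau (hd : ∀ i, 0 < d i) (A : Filling d) :
    rowSum (push (tauTransversal d) A) = rowSum A := by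
  funext i
  rw [rowSum, Finset.sum_eq_single (tauIndex hd i)]
  · exact if_pos ((mem_tauTransversal_iff hd).mpr rfl)
  · intro α _ hα
    exact if_neg fun h => hα ((mem_tauTransversal_iff hd).mp h)
  · exact fun h => absurd (Finset.mem_univ _) h

theorem supernomial_push_tau (hd : ∀ i, 0 < d i) (A : Filling d) :
    supernomial (rowSum A) (push (tauTransversal d) A) = 1 := by
  have h : ∏ c, (push (tauTransversal d) A c).factorial = ∏ i, (rowSum A i).factorial := by
    rw [Fintype.prod_sigma]
    refine Finset.prod_congr rfl fun i _ => ?_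
    rw [Finset.prod_eq_single (tauIndex hd i)]
    · rw [push, if_pos ((mem_tauTransversal_iff hd).mpr rfl)]
    · intro α _ hα
      rw [push, if_neg fun h => hα ((mem_tauTransversal_iff hd).mp h)]
      rfl
    · exact fun h => absurd (Finset.mem_univ _) h
  rw [supernomial, h]
  exact Nat.div_self (Finset.prod_pos fun i _ => Nat.factorial_pos _)

theorem rowSum_resolventFilling (hd : ∀ i, 0 < d i) (A : Filling d) :
    rowSum (resolventFilling A) = rowSum A := by
  rw [← rowSum_restrict_add_compl (diagTransversal d) A, add_comm,
    ← rowSum_push_tau hd (restrict (diagTransversal d) A)]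
  funext i
  simp only [rowSum, resolventFilling, Pi.add_apply, Finset.sum_add_distrib]

/-- No diagonal variable survives the elimination, so a monomial to be compared must avoid `𝔼`; this
is why the diagonal entries of `A` are pushed to a disjoint transversal. -/
theorem resolventFilling_of_mem_diag (hn : 2 ≤ n) (hd : ∀ i, 0 < d i) (A : Filling d) {c : Cell d}
    (hc : c ∈ diagTransversal d) : resolventFilling A c = 0 := by
  have hc' : c ∉ tauTransversal d := Finset.disjoint_left.mp (disjoint_diag_tau hn hd) hc
  simp [resolventFilling, restrict, push, hc, hc']

/-- The differences, on the diagonal, of two fillings of equal weight that agree off `𝔼 ∪ 𝕋`. -/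
theorem diag_recursion (hn : 2 ≤ n) (hd : ∀ i, 0 < d i) {f : Cell d → ℤ}
    (hf : ∀ c ∉ diagTransversal d ∪ tauTransversal d, f c = 0)
    (hrow : ∀ i, ∑ α : Multiindex n (d i), f ⟨i, α⟩ = 0)
    (hwt : ∀ j, ∑ c : Cell d, f c * (c.2.1 j : ℤ) = 0) :
    (∀ i, f ⟨i, tauIndex hd i⟩ = -f ⟨i, diagIndex d i⟩) ∧
      ∀ (k : ℕ) (hk : k + 1 < n), f ⟨⟨k, by omega⟩, diagIndex d _⟩
        = d ⟨k + 1, hk⟩ * f ⟨⟨k + 1, hk⟩, diagIndex d _⟩ := by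
  have hsum : ∀ (i : Fin n) (g : Multiindex n (d i) → ℤ),
      ∑ α, f ⟨i, α⟩ * g α = f ⟨i, diagIndex d i⟩ * g (diagIndex d i)
        + f ⟨i, tauIndex hd i⟩ * g (tauIndex hd i) := by
    intro i g
    rw [← Finset.sum_pair (f := fun α => f ⟨i, α⟩ * g α) (tauIndex_ne_diagIndex hn hd i).symm]
    refine (Finset.sum_subset (Finset.subset_univ _) fun α _ hα => ?_).symm
    rw [hf, zero_mul]
    rw [Finset.mem_union, mem_diagTransversal_iff, mem_tauTransversal_iff hd]
    simpa using hα
  have htau : ∀ i, f ⟨i, tauIndex hd i⟩ = -f ⟨i, diagIndex d i⟩ := by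
    intro i
    have h1 := hrow i
    have h2 := hsum i fun _ => 1
    simp only [mul_one] at h2
    linarith
  refine ⟨htau, fun k hk => ?_⟩
  -- In the variable `k + 1`, which is never the variable `0`, only two cells count: the diagonal
  -- cell of row `k + 1`, with exponent `d_{k+1}`, and the `τ` cell of row `k`, with exponent `1`.
  have h := hwt ⟨k + 1, hk⟩
  rw [Fintype.sum_sigma] at h
  dsimp only at h
  rw [Finset.sum_congr rfl fun i _ => hsum i fun α => (α.1 ⟨k + 1, hk⟩ : ℤ),
    Finset.sum_add_distrib, Finset.sum_eq_single ⟨k + 1, hk⟩, Finset.sum_eq_single ⟨k, by omega⟩,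
    htau] at h
  · have h1 : (diagIndex d ⟨k + 1, hk⟩).1 ⟨k + 1, hk⟩ = d ⟨k + 1, hk⟩ := Pi.single_eq_same _ _
    have h2 : (tauIndex hd ⟨k, by omega⟩).1 ⟨k + 1, hk⟩ = 1 := by
      simp [tauIndex, tauRow, hk, Fin.ext_iff]
    rw [h1, h2] at h
    push_cast at h
    linarith
  · intro i _ hi
    have h2 : (tauIndex hd i).1 ⟨k + 1, hk⟩ = 0 := by
      have hi' : k ≠ i.1 := fun h => hi (Fin.ext h.symm)
      unfold tauIndex tauRow
      split_ifs <;> simp [Fin.ext_iff, hi']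
    rw [h2, Nat.cast_zero, mul_zero]
  · exact fun h => absurd (Finset.mem_univ _) h
  · intro i _ hi
    have h2 : (diagIndex d i).1 ⟨k + 1, hk⟩ = 0 := Pi.single_eq_of_ne hi.symm _
    rw [h2, Nat.cast_zero, mul_zero]
  · exact fun h => absurd (Finset.mem_univ _) h

/-- Telescoping down to the last row gives `u 0` as the last `u` times the product of all degrees
but the first. -/
theorem canonicalDegree_dvd_of_recursion {u : Fin n → ℤ}
    (hu : ∀ (k : ℕ) (hk : k + 1 < n), u ⟨k, by omega⟩ = d ⟨k + 1, hk⟩ * u ⟨k + 1, hk⟩) :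
    (canonicalDegree d 0 : ℤ) ∣ u 0 := by
  have hpos : 0 < n := Nat.pos_of_ne_zero (NeZero.ne n)
  have key : ∀ (k : ℕ) (hk : k < n),
      u 0 = ((∏ i : Fin n with 0 < i.1 ∧ i.1 ≤ k, d i : ℕ) : ℤ) * u ⟨k, hk⟩ := by
    intro k
    induction k with
    | zero =>
      intro hk
      rw [Finset.filter_false_of_mem fun i _ => by omega]
      simp only [Finset.prod_empty, Nat.cast_one, one_mul]
      rfl
    | succ k ih =>
      intro hk
      rw [ih (by omega), hu k hk, ← mul_assoc, ← Nat.cast_mul]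
      have hins : (Finset.univ.filter fun i : Fin n => 0 < i.1 ∧ i.1 ≤ k + 1)
          = insert ⟨k + 1, hk⟩ (Finset.univ.filter fun i : Fin n => 0 < i.1 ∧ i.1 ≤ k) := by
        ext i
        simp only [Finset.mem_filter, Finset.mem_univ, true_and, Finset.mem_insert, Fin.ext_iff]
        omega
      rw [hins, Finset.prod_insert (by simp), mul_comm (d _)]
  have hall : (Finset.univ.filter fun i : Fin n => 0 < i.1 ∧ i.1 ≤ n - 1)
      = Finset.univ.erase 0 := by
    ext i
    have := i.2
    simp only [Finset.mem_filter, Finset.mem_univ, true_and, Finset.mem_erase, and_true, ne_eq,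
      Fin.ext_iff, Fin.val_zero]
    omega
  refine ⟨u ⟨n - 1, by omega⟩, ?_⟩
  rw [key (n - 1) (by omega), hall, canonicalDegree]

theorem eq_zero_of_recursion (hd : ∀ i, 0 < d i) {u : Fin n → ℤ}
    (hu : ∀ (k : ℕ) (hk : k + 1 < n), u ⟨k, by omega⟩ = d ⟨k + 1, hk⟩ * u ⟨k + 1, hk⟩)
    (h0 : u 0 = 0) (i : Fin n) : u i = 0 := by
  obtain ⟨k, hk⟩ := i
  induction k with
  | zero => exact h0
  | succ k ih =>
    have h := hu k hk
    rw [ih, eq_comm, mul_eq_zero] at h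
    exact h.resolve_left (Nat.cast_ne_zero.mpr (hd _).ne')

theorem firstEntry_lt {A : Filling d} (hA : A ∈ REF d) (hA' : A ∉ FRR d) :
    A ⟨0, diagIndex d 0⟩ < canonicalDegree d 0 := by
  refine lt_of_le_of_ne ?_ fun h => hA' (Finset.mem_filter.mpr ⟨hA, h⟩)
  rw [← rowSum_of_mem_REF hA]
  exact Finset.single_le_sum (f := fun α => A ⟨0, α⟩) (fun _ _ => Nat.zero_le _)
    (Finset.mem_univ _)

/-- Fillings in `REF` that agree off `𝔼 ∪ 𝕋` and are not first-row-reduced are equal. -/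
theorem eq_of_agree (hn : 2 ≤ n) (hd : ∀ i, 0 < d i) {A A' : Filling d} (hA : A ∈ REF d)
    (hA' : A' ∈ REF d) (hAF : A ∉ FRR d) (hAF' : A' ∉ FRR d)
    (h : ∀ c ∉ diagTransversal d ∪ tauTransversal d, A' c = A c) : A' = A := by
  have hrow : ∀ i, ∑ α : Multiindex n (d i), ((A' ⟨i, α⟩ : ℤ) - A ⟨i, α⟩) = 0 := by
    intro i
    have h1 := congrFun (rowSum_of_mem_REF hA') i
    rw [← rowSum_of_mem_REF hA] at h1
    rw [Finset.sum_sub_distrib, sub_eq_zero]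
    exact_mod_cast h1
  have hwt : ∀ j, ∑ c : Cell d, ((A' c : ℤ) - A c) * (c.2.1 j : ℤ) = 0 := by
    intro j
    have h1 := congrFun ((Finset.mem_filter.mp hA').2.trans (Finset.mem_filter.mp hA).2.symm) j
    simp only [sub_mul]
    rw [Finset.sum_sub_distrib, sub_eq_zero]
    exact_mod_cast h1
  obtain ⟨htau, hrec⟩ := diag_recursion hn hd (f := fun c => (A' c : ℤ) - A c)
    (fun c hc => by rw [h c hc, sub_self]) hrow hwt
  -- Outside `FRR` both entries are strictly below `δ_0`, so a difference divisible by `δ_0` is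
  -- zero.
  have h0 : (A' ⟨0, diagIndex d 0⟩ : ℤ) - A ⟨0, diagIndex d 0⟩ = 0 := by
    have hlt := firstEntry_lt hA hAF
    have hlt' := firstEntry_lt hA' hAF'
    refine Int.eq_zero_of_abs_lt_dvd
      (canonicalDegree_dvd_of_recursion
        (u := fun i => (A' ⟨i, diagIndex d i⟩ : ℤ) - A ⟨i, diagIndex d i⟩) hrec) ?_
    rw [abs_lt]
    omega
  have hdiag := eq_zero_of_recursion hd
    (u := fun i => (A' ⟨i, diagIndex d i⟩ : ℤ) - A ⟨i, diagIndex d i⟩) hrec h0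
  funext ⟨i, α⟩
  by_cases hE : (⟨i, α⟩ : Cell d) ∈ diagTransversal d
  · rw [mem_diagTransversal_iff] at hE
    have := hdiag i
    subst hE
    omega
  · by_cases hT : (⟨i, α⟩ : Cell d) ∈ tauTransversal d
    · rw [mem_tauTransversal_iff hd] at hT
      have h1 := hdiag i
      have h2 := htau i
      subst hT
      omega
    · exact h _ (by simp [hE, hT])

/-- Only smaller fillings, and `A` itself, contribute to the relation attached to `A`. -/
theorem prec_of_le_resolventFilling (hn : 2 ≤ n) (hd : ∀ i, 0 < d i) {A A' : Filling d}
    (hA : A ∈ REF d) (hA' : A' ∈ REF d) (hAF : A ∉ FRR d) (hne : A' ≠ A)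
    (h : ∀ c, restrict (diagTransversal d)ᶜ A' c ≤ resolventFilling A c) : Prec A' A := by
  by_cases hAF' : A' ∈ FRR d
  · exact Or.inl ⟨hAF', hAF⟩
  refine Or.inr ⟨⟨hAF', hAF⟩, ?_⟩
  have hle : ∀ c ∈ Finset.univ, restrict (diagTransversal d ∪ tauTransversal d)ᶜ A' c
      ≤ restrict (diagTransversal d ∪ tauTransversal d)ᶜ A c := by
    intro c _
    have hc := h c
    by_cases hE : c ∈ diagTransversal d
    · simp [restrict, hE]
    by_cases hT : c ∈ tauTransversal d
    · simp [restrict, hT]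
    simpa [restrict, resolventFilling, push, hE, hT] using hc
  refine lt_of_le_of_ne (Finset.sum_le_sum hle) fun heq => hne ?_
  refine eq_of_agree hn hd hA hA' hAF hAF' fun c hc => ?_
  -- Cellwise comparable fillings with equal totals coincide.
  have := (Finset.sum_eq_sum_iff_of_le hle).mp heq c (Finset.mem_univ c)
  simpa only [restrict, Finset.mem_compl, if_pos hc] using this

theorem not_prec_self (A : Filling d) : ¬ Prec A A := by
  rintro (h | h)
  · exact h.2 h.1
  · exact lt_irrefl _ h.2

/-- What remains of `C_A` is the push itself, with one possibly nonzero entry in each row, so all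
multinomials are `1`; the sign exponent is odd. -/
theorem transition_self (hd : ∀ i, 0 < d i) (A : Filling d) : transition A A = -1 := by
  have hle : ∀ c, restrict (diagTransversal d)ᶜ A c ≤ resolventFilling A c :=
    fun c => Nat.le_add_right _ _
  have hsub : resolventFilling A - restrict (diagTransversal d)ᶜ A
      = push (tauTransversal d) (restrict (diagTransversal d) A) := by
    funext c
    simp [resolventFilling]
  rw [transition, if_pos hle, hsub, supernomial_push_tau hd, pow_succ, ← two_mul, pow_mul]
  simp

/-- The linear relation attached to `A`. -/
theorem VanishesOnSolvable.sum_transition_eq_zero (hn : 2 ≤ n) (hd : ∀ i, 0 < d i)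
    {R : MvPolynomial (Cell d) ℚ} (hR : VanishesOnSolvable R)
    (hδ : IsMultihomogeneous R (canonicalDegree d)) {A : Filling d} (hA : A ∈ REF d) :
    ∑ A' ∈ REF d, (transition A A' : ℚ) * fillingCoeff R A' = 0 := by
  have h := congrArg
    (MvPolynomial.coeff (Finsupp.equivFunOnFinite.symm (resolventFilling A)))
    (hR.sum_zeroSumSubst_eq_zero hδ)
  rw [MvPolynomial.coeff_sum, MvPolynomial.coeff_zero] at h
  -- The elimination yields only the sign of the diagonal part of `A'`. The rest of the sign in `𝒯`
  -- depends on `A` alone, so it factors out of the sum.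
  have hterm : ∀ A' ∈ REF d,
      MvPolynomial.coeff (Finsupp.equivFunOnFinite.symm (resolventFilling A))
        (MvPolynomial.C (fillingCoeff R A' : ℂ) *
          ∏ c, zeroSumSubst (MvPolynomial.X : Cell d → MvPolynomial (Cell d) ℂ) c ^ A' c)
      = (-1) ^ (total (restrict (diagTransversal d) A) + 1) *
          ((transition A A' : ℂ) * fillingCoeff R A') := by
    intro A' hA'
    rw [MvPolynomial.coeff_C_mul, coeff_prod_zeroSumSubst_pow
      (fun c hc => resolventFilling_of_mem_diag hn hd A hc)
      ((rowSum_resolventFilling hd A).trans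
        ((rowSum_of_mem_REF hA).trans (rowSum_of_mem_REF hA').symm)), transition]
    split_ifs with hle
    · have hsq : ((-1 : ℂ) ^ total (restrict (diagTransversal d) A)) ^ 2 = 1 := by
        rw [← pow_mul, mul_comm, pow_mul]
        simp
      push_cast
      rw [pow_add, pow_add, pow_add]
      linear_combination (-(fillingCoeff R A' : ℂ) *
        (-1) ^ total (restrict (diagTransversal d) A') *
        (supernomial (rowSum (restrict (diagTransversal d) A'))
          (resolventFilling A - restrict (diagTransversal d)ᶜ A') : ℂ)) * hsq
    · simp
  rw [Finset.sum_congr rfl hterm, ← Finset.mul_sum] at h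
  have h' := (mul_eq_zero.mp h).resolve_left (pow_ne_zero _ (by norm_num))
  exact_mod_cast h'

theorem VanishesOnSolvable.fillingCoeff_eq (hn : 2 ≤ n) (hd : ∀ i, 0 < d i)
    {R : MvPolynomial (Cell d) ℚ} (hR : VanishesOnSolvable R)
    (hδ : IsMultihomogeneous R (canonicalDegree d)) {A : Filling d} (hA : A ∈ REF d)
    (hAF : A ∉ FRR d) :
    fillingCoeff R A
      = ∑ A' ∈ REF d with Prec A' A, (transition A A' : ℚ) * fillingCoeff R A' := by
  have h := hR.sum_transition_eq_zero hn hd hδ hA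
  rw [← Finset.add_sum_erase _ _ hA, transition_self hd] at h
  have hsub : (REF d).filter (Prec · A) ⊆ (REF d).erase A := by
    intro A' hA'
    rw [Finset.mem_filter] at hA'
    refine Finset.mem_erase.mpr ⟨?_, hA'.1⟩
    rintro rfl
    exact not_prec_self _ hA'.2
  rw [Finset.sum_subset hsub]
  · push_cast at h
    linarith
  · intro A' hA' hnot
    rw [Finset.mem_erase] at hA'
    rw [transition, if_neg, Int.cast_zero, zero_mul]
    intro hle
    exact hnot (Finset.mem_filter.mpr
      ⟨hA'.2, prec_of_le_resolventFilling hn hd hA hA'.2 hAF hA'.1 hle⟩)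

end Order

/-! ### Iteration of the transitions along chains -/

section Paths

variable {n : ℕ} {d : Fin n → ℕ}

theorem path_cons {k : ℕ} (A A₁ : Filling d) (p : Fin k → Filling d) (B : Filling d) :
    path A (Fin.cons A₁ p : Fin (k + 1) → Filling d) B
      = (Fin.cons A (path A₁ p B) : Fin (k + 3) → Filling d) := by
  unfold path
  rw [← Fin.cons_snoc_eq_snoc_cons]

variable [NeZero n]

theorem pathSum_zero (A B : Filling d) :
    pathSum 0 A B = if Prec B A then transition A B else 0 := by
  unfold pathSum
  rw [Finset.sum_filter, Fintype.piFinset_of_isEmpty, Finset.univ_unique, Finset.sum_singleton]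
  simp only [Fin.forall_fin_one, Nat.reduceAdd, Finset.univ_unique, Finset.prod_singleton]
  rfl

/-- Removing the first intermediate filling from a chain splits off one order condition and one
factor. -/
theorem pathSum_succ (k : ℕ) (A B : Filling d) :
    pathSum (k + 1) A B
      = ∑ A₁ ∈ REF d \ FRR d with Prec A₁ A, transition A A₁ * pathSum k A₁ B := by
  unfold pathSum
  simp only [Finset.sum_filter, Finset.mul_sum]
  have : ∀ A₁ : Filling d, (if Prec A₁ A then
        ∑ p ∈ Fintype.piFinset (fun _ : Fin k => REF d \ FRR d), transition A A₁ *
          (if ∀ i : Fin (k + 1), Prec (path A₁ p B i.succ) (path A₁ p B i.castSucc) then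
            ∏ i : Fin (k + 1), transition (path A₁ p B i.castSucc) (path A₁ p B i.succ) else 0)
        else 0)
      = ∑ p ∈ Fintype.piFinset (fun _ : Fin k => REF d \ FRR d),
        if Prec A₁ A ∧
            ∀ i : Fin (k + 1), Prec (path A₁ p B i.succ) (path A₁ p B i.castSucc) then
          transition A A₁ *
            ∏ i : Fin (k + 1), transition (path A₁ p B i.castSucc) (path A₁ p B i.succ)
        else 0 := by
    intro A₁
    by_cases h : Prec A₁ A
    · simp only [h, if_true, true_and, mul_ite, mul_zero]
    · simp only [h, false_and, if_false, Finset.sum_const_zero]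
  simp only [this]
  rw [← Finset.sum_product']
  refine Finset.sum_bij' (fun p _ => (p 0, Fin.tail p))
    (fun q _ => (Fin.cons q.1 q.2 : Fin (k + 1) → Filling d)) ?_ ?_ ?_ ?_ ?_
  · intro p hp
    rw [Fintype.mem_piFinset] at hp
    exact Finset.mem_product.mpr ⟨hp 0, Fintype.mem_piFinset.mpr fun i => hp i.succ⟩
  · intro q hq
    obtain ⟨h1, h2⟩ := Finset.mem_product.mp hq
    rw [Fintype.mem_piFinset] at h2 ⊢
    exact Fin.cases h1 h2
  · intro p _
    exact Fin.cons_self_tail p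
  · intro q _
    simp
  · intro p _
    obtain ⟨A₁, q, rfl⟩ : ∃ A₁ q, p = (Fin.cons A₁ q : Fin (k + 1) → Filling d) :=
      ⟨p 0, Fin.tail p, (Fin.cons_self_tail p).symm⟩
    simp only [path_cons, Fin.forall_fin_succ (n := k + 1), Fin.prod_univ_succ (n := k + 1),
      Fin.cons_succ, Fin.cons_zero, Fin.tail_cons, Fin.castSucc_zero, ← Fin.succ_castSucc]
    rfl

/-- Any bound above the counter is allowed, so that coefficients for different starting fillings can
be summed over a common range. -/
theorem reductionCoeff_eq_sum_range {A : Filling d} (hA : A ∉ FRR d) (B : Filling d) {N : ℕ}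
    (hN : counter A < N) : reductionCoeff A B = ∑ k ∈ Finset.range N, pathSum k A B := by
  rw [reductionCoeff, if_neg hA, finsum_eq_sum_of_support_subset]
  intro k hk
  rw [Finset.coe_range, Set.mem_Iio]
  by_contra h
  exact hk (pathSum_eq_zero B (by omega))

theorem counter_lt_of_prec {A A' : Filling d} (hA' : A' ∉ FRR d) (h : Prec A' A) :
    counter A' < counter A :=
  h.elim (fun h => absurd h.1 hA') (fun h => h.2)

/-- Conditioning the chains on their first step. -/
theorem reductionCoeff_recursion {A B : Filling d} (hA : A ∉ FRR d) (hB : B ∈ FRR d) :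
    reductionCoeff A B = transition A B
      + ∑ A₁ ∈ REF d \ FRR d with Prec A₁ A, transition A A₁ * reductionCoeff A₁ B := by
  -- Splitting off `k = 0` leaves `counter A + 1` lengths, enough for every `A₁`, whose counter is
  -- smaller than that of `A`.
  rw [reductionCoeff_eq_sum_range hA B (N := counter A + 1 + 1) (by omega),
    Finset.sum_range_succ', pathSum_zero, if_pos (Or.inl ⟨hB, hA⟩), add_comm]
  congr 1
  simp only [pathSum_succ]
  rw [Finset.sum_comm]
  refine Finset.sum_congr rfl fun A₁ h => ?_
  rw [Finset.mem_filter, Finset.mem_sdiff] at h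
  have := counter_lt_of_prec h.1.2 h.2
  rw [← Finset.mul_sum, reductionCoeff_eq_sum_range h.1.2 B (N := counter A + 1) (by omega)]

/-- Iterating the transitions expresses everything through the first-row-reduced fillings. -/
theorem eq_sum_reductionCoeff {r : Filling d → ℚ}
    (hr : ∀ A ∈ REF d \ FRR d,
      r A = ∑ A' ∈ REF d with Prec A' A, (transition A A' : ℚ) * r A')
    {A : Filling d} (hA : A ∈ REF d) :
    r A = ∑ B ∈ FRR d, (reductionCoeff A B : ℚ) * r B := by
  -- The counter need not drop on entering `FRR`, but the terms there are already in final form;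
  -- only the others use the induction hypothesis.
  induction hc : counter A using Nat.strong_induction_on generalizing A with
  | _ m ih =>
    by_cases hAF : A ∈ FRR d
    · simp [reductionCoeff, hAF, ite_mul]
    · have hsplit : (REF d).filter (Prec · A)
          = FRR d ∪ (REF d \ FRR d).filter (Prec · A) := by
        ext A'
        simp only [Finset.mem_filter, Finset.mem_union, Finset.mem_sdiff]
        constructor
        · rintro ⟨h1, h2⟩
          by_cases h : A' ∈ FRR d
          · exact Or.inl h
          · exact Or.inr ⟨⟨h1, h⟩, h2⟩
        · rintro (h | h)
          · exact ⟨(Finset.mem_filter.mp h).1, Or.inl ⟨h, hAF⟩⟩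
          · exact ⟨h.1.1, h.2⟩
      have hdisj : Disjoint (FRR d) ((REF d \ FRR d).filter (Prec · A)) :=
        Finset.disjoint_sdiff.mono_right (Finset.filter_subset _ _)
      rw [hr A (Finset.mem_sdiff.mpr ⟨hA, hAF⟩), hsplit, Finset.sum_union hdisj]
      have hih : ∀ A' ∈ (REF d \ FRR d).filter (Prec · A), (transition A A' : ℚ) * r A'
          = ∑ B ∈ FRR d, (transition A A' : ℚ) * ((reductionCoeff A' B : ℚ) * r B) := by
        intro A' h
        rw [Finset.mem_filter, Finset.mem_sdiff] at h
        rw [ih _ (hc ▸ counter_lt_of_prec h.1.2 h.2) h.1.1 rfl, Finset.mul_sum]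
      rw [Finset.sum_congr rfl hih, Finset.sum_comm, ← Finset.sum_add_distrib]
      refine Finset.sum_congr rfl fun B hB => ?_
      rw [reductionCoeff_recursion hAF hB]
      push_cast
      rw [add_mul, Finset.sum_mul]
      simp only [mul_assoc]

end Paths

end InertiaForms

theorem mainTheorem5 (n : ℕ) [NeZero n] (hn : 2 ≤ n) (d : Fin n → ℕ) (hd : ∀ i, 0 < d i)
    (R : MvPolynomial (Cell d) ℚ)
    (hR : (IsInertiaForm d R ∧ IsMultihomogeneous R (canonicalDegree d)) ∨ IsResultant d R) :
    (∀ A ∈ REF d \ FRR d,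
      fillingCoeff R A
        = ∑ A' ∈ REF d with Prec A' A, (transition A A' : ℚ) * fillingCoeff R A') ∧
    (∀ A ∈ REF d,
      fillingCoeff R A = ∑ B ∈ FRR d, (reductionCoeff A B : ℚ) * fillingCoeff R B) := by
  have hV : VanishesOnSolvable R :=
    hR.elim (fun h => h.1.vanishesOnSolvable) (fun h => h.vanishesOnSolvable)
  have hδ : IsMultihomogeneous R (canonicalDegree d) := hR.elim (fun h => h.2) (·.multidegree)
  have hrec : ∀ A ∈ REF d \ FRR d, fillingCoeff R A
      = ∑ A' ∈ REF d with Prec A' A, (transition A A' : ℚ) * fillingCoeff R A' := by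
    intro A hA
    rw [Finset.mem_sdiff] at hA
    exact hV.fillingCoeff_eq hn hd hδ hA.1 hA.2
  exact ⟨hrec, fun A hA => eq_sum_reductionCoeff hrec hA⟩
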